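/- For positive integers $p,q,n$, the biased clique game $\mathrm{Clique}_{(p,q)}(n)$ is played on the edges of the complete graph $K_n$, all uncoloured at the start. Alice (player 1) and Bob (player 2) alternate turns, Alice moving first. On each of her turns Alice colours $p$ uncoloured edges red, and on each of his turns Bob colours $q$ uncoloured edges blue; a player facing fewer uncoloured edges than that colours all of them. When all edges are coloured, let $a$ and $b$ be the clique numbers of the graphs on the vertex set of $K_n$ formed by the red and by the blue edges, respectively. The game is won by player 2 if Bob has a strategy which guarantees $b>a$ at the end, however Alice plays. There is an absolute constant $c>0$ such that for all positive integers $p,q$ with $q>cp^2$ there is an $n_0=n_0(p,q)$ such that for every $n\ge n_0$ the game $\mathrm{Clique}_{(p,q)}(n)$ is won by player 2. -/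

import Mathlib

namespace CliqueGame

/-- A position of the edge-colouring game: the edges coloured red (by Alice, the first player)
and the edges coloured blue (by Bob, the second player) so far. -/
structure Position (V : Type*) where
  red : Finset (Sym2 V)
  blue : Finset (Sym2 V)

section

variable {V : Type*} [Fintype V] [DecidableEq V] (G : SimpleGraph V) [DecidableRel G.Adj]

/-- The edges of the board `G` that have not been coloured yet. -/
def uncoloured (P : Position V) : Finset (Sym2 V) :=
  G.edgeFinset \ (P.red ∪ P.blue)

/-- In a turn with bias `m` a player colours a set `M` of exactly `m` uncoloured edges, or all of
the uncoloured edges if fewer than `m` are left. -/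
def IsMove (m : ℕ) (P : Position V) (M : Finset (Sym2 V)) : Prop :=
  M ⊆ uncoloured G P ∧ M.card = min m (uncoloured G P).card

/-- Alice colours the edges of `M` red. -/
def Position.addRed (P : Position V) (M : Finset (Sym2 V)) : Position V :=
  ⟨P.red ∪ M, P.blue⟩

/-- Bob colours the edges of `M` blue. -/
def Position.addBlue (P : Position V) (M : Finset (Sym2 V)) : Position V :=
  ⟨P.red, P.blue ∪ M⟩

/-- A strategy of Bob with bias `q`: in every position it names a legal move for Bob. -/
def IsStrategy (q : ℕ) (σ : Position V → Finset (Sym2 V)) : Prop :=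
  ∀ P : Position V, IsMove G q P (σ P)

/-- The positions with Alice to move that can arise when Alice moves first, colours `p` edges per
turn in an arbitrary way, and Bob answers by `σ`. Once Alice has coloured the last edge, Bob's
answer is empty, so every completed play ends in such a position. -/
inductive Reachable (p : ℕ) (σ : Position V → Finset (Sym2 V)) : Position V → Prop
  | start : Reachable p σ ⟨∅, ∅⟩
  | round (P : Position V) (M : Finset (Sym2 V)) (hP : Reachable p σ P) (hM : IsMove G p P M) :
      Reachable p σ ((P.addRed M).addBlue (σ (P.addRed M)))

/-- The `(p, q)`-biased clique game on `G` is won by the second player: Bob has a strategy such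
that, whatever Alice does, when all edges are coloured the clique number of the blue graph
strictly exceeds the clique number of the red graph. -/
def SecondPlayerWins (p q : ℕ) : Prop :=
  ∃ σ : Position V → Finset (Sym2 V), IsStrategy G q σ ∧
    ∀ P : Position V, Reachable G p σ P → uncoloured G P = ∅ →
      (SimpleGraph.fromEdgeSet (P.red : Set (Sym2 V))).cliqueNum <
        (SimpleGraph.fromEdgeSet (P.blue : Set (Sym2 V))).cliqueNum

end

end CliqueGame

/-!
Write `q = r + 1`, where `r ≥ 16 p²`. With one edge of every turn Bob plays the biased
Erdős–Selfridge breaker (Beck) against the red cliques with `L = 2p(⌊log₂ n⌋ + 1) + 1` vertices,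
which are too few, for their number of edges, to let Alice complete one of them.

With the other `r` edges he builds a blue clique with `L` vertices, one vertex at a time, and keeps
a large set of candidates for its next vertex. He joins the newest vertex to the candidates, `r` per
turn, while Alice spoils at most `p` of them, so that he loses about the proportion `p / r`.
Afterwards Alice has only `O(p n L)` edges, so that some candidate has small red degree; it becomes
the next vertex. In the end at least the proportion `(1 - 2p/r) ^ L` of the `n` vertices would be
left. Since `(1 - 2p/r) ^ (2p) ≥ 1 - 4p²/r ≥ 3/4` by Bernoulli's inequality, this is at least
`(3/4) ^ (⌊log₂ n⌋ + 2)`, and because `2 · (3/4)² > 1` the losses of lower order are negligible for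
large `n`.
-/

open Finset

namespace CliqueGame

section Breaker

variable {α : Type*} [DecidableEq α] {F : Finset (Finset α)} {E R B M A : Finset α} {p : ℕ} {C : ℝ}

/-- The Erdős–Selfridge weight of a winning set `A` when the player with bias `p` has claimed `R`:
it at most doubles in a turn of `p` claims. -/
noncomputable def weight (p : ℕ) (R A : Finset α) : ℝ :=
  2 ^ ((#(A ∩ R) : ℝ) / p)

/-- The biased Erdős–Selfridge potential: the total weight of the members of `F` in which the
breaker, who has claimed `B`, owns no element. -/
noncomputable def potential (F : Finset (Finset α)) (p : ℕ) (R B : Finset α) : ℝ :=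
  ∑ A ∈ F with Disjoint A B, weight p R A

/-- The danger of an element `e`: the part of the potential that the breaker removes by
claiming `e`. -/
noncomputable def danger (F : Finset (Finset α)) (p : ℕ) (R B : Finset α) (e : α) : ℝ :=
  potential {A ∈ F | e ∈ A} p R B

lemma weight_pos (p : ℕ) (R A : Finset α) : 0 < weight p R A := by
  unfold weight
  positivity

lemma potential_nonneg (F : Finset (Finset α)) (p : ℕ) (R B : Finset α) :
    0 ≤ potential F p R B :=
  sum_nonneg fun A _ => (weight_pos p R A).le

lemma potential_anti_right (F : Finset (Finset α)) (p : ℕ) (R : Finset α) {B B' : Finset α}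
    (hB : B ⊆ B') : potential F p R B' ≤ potential F p R B :=
  sum_le_sum_of_subset_of_nonneg (monotone_filter_right _ fun _ _ hA => hA.mono_right hB)
    fun A _ _ => (weight_pos p R A).le

lemma danger_le_potential (F : Finset (Finset α)) (p : ℕ) (R B : Finset α) (e : α) :
    danger F p R B e ≤ potential F p R B :=
  sum_le_sum_of_subset_of_nonneg (filter_subset_filter _ (filter_subset _ _))
    fun A _ _ => (weight_pos p R A).le

lemma potential_insert_add_danger (F : Finset (Finset α)) (p : ℕ) (R B : Finset α) (e : α) :
    potential F p R (insert e B) + danger F p R B e = potential F p R B := by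
  have hinsert : {A ∈ F | Disjoint A (insert e B)} = {A ∈ {A ∈ F | Disjoint A B} | e ∉ A} := by
    ext A
    simp only [mem_filter, disjoint_insert_right]
    tauto
  rw [danger, potential, potential, potential, hinsert, filter_comm (p := (e ∈ ·)), add_comm]
  exact sum_filter_add_sum_filter_not {A ∈ F | Disjoint A B} (e ∈ ·) (weight p R)

lemma weight_union_le (hp : 0 < p) (R A : Finset α) (hM : #M ≤ p) :
    weight p (R ∪ M) A ≤ weight p R A + #(A ∩ M) * weight p R A / p := by
  have hp' : (0 : ℝ) < p := by exact_mod_cast hp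
  have hcard : #(A ∩ (R ∪ M)) ≤ #(A ∩ R) + #(A ∩ M) := by
    rw [inter_union_distrib_left]
    exact card_union_le _ _
  have hbernoulli : (2 : ℝ) ^ ((#(A ∩ M) : ℝ) / p) ≤ 1 + #(A ∩ M) / p := by
    have hle : (#(A ∩ M) : ℝ) / p ≤ 1 := by
      rw [div_le_one hp']
      exact_mod_cast (card_le_card inter_subset_right).trans hM
    simpa [one_add_one_eq_two] using
      rpow_one_add_le_one_add_mul_self (s := 1) (by norm_num) (by positivity) hle
  calc weight p (R ∪ M) A
      ≤ 2 ^ ((#(A ∩ R) : ℝ) / p + #(A ∩ M) / p) := by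
        rw [weight, ← add_div]
        gcongr
        · norm_num
        · exact_mod_cast hcard
    _ = weight p R A * 2 ^ ((#(A ∩ M) : ℝ) / p) := Real.rpow_add two_pos _ _
    _ ≤ weight p R A * (1 + #(A ∩ M) / p) := by
        gcongr
        exact (weight_pos p R A).le
    _ = _ := by ring

lemma sum_danger (F : Finset (Finset α)) (p : ℕ) (R B M : Finset α) :
    ∑ e ∈ M, danger F p R B e = ∑ A ∈ F with Disjoint A B, #(A ∩ M) * weight p R A := by
  simp only [danger, potential, filter_comm (p := (_ ∈ ·)), sum_filter _ (fun A => weight p R A)]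
  rw [sum_comm]
  refine sum_congr rfl fun A _ => ?_
  rw [← sum_filter, sum_const, nsmul_eq_mul, filter_mem_eq_inter, inter_comm]

lemma potential_union_le (hp : 0 < p) (hM : #M ≤ p) {m : ℝ} (hm : 0 ≤ m)
    (hdanger : ∀ e ∈ M, danger F p R B e ≤ m) :
    potential F p (R ∪ M) B ≤ potential F p R B + m := by
  have hp' : (0 : ℝ) < p := by exact_mod_cast hp
  calc potential F p (R ∪ M) B
      ≤ ∑ A ∈ F with Disjoint A B, (weight p R A + #(A ∩ M) * weight p R A / p) :=
        sum_le_sum fun A _ => weight_union_le hp R A hM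
    _ = potential F p R B + (∑ e ∈ M, danger F p R B e) / p := by
        rw [sum_add_distrib, ← sum_div, sum_danger, potential]
    _ ≤ potential F p R B + p * m / p := by
        gcongr
        calc ∑ e ∈ M, danger F p R B e ≤ #M * m := by
              simpa only [nsmul_eq_mul] using sum_le_card_nsmul M _ m hdanger
          _ ≤ p * m := by gcongr
    _ = potential F p R B + m := by rw [mul_div_cancel_left₀ _ hp'.ne']

/-- A position of the game on the board `E` is safe if the potential stays at most `C` even after
`p` further claims, each adding at most the `p`-th part of the largest danger. -/
def IsSafe (F : Finset (Finset α)) (E : Finset α) (p : ℕ) (C : ℝ) (R B : Finset α) : Prop :=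
  ∃ m : ℝ, 0 ≤ m ∧ (∀ e ∈ E \ (R ∪ B), danger F p R B e ≤ m) ∧ potential F p R B + m ≤ C

lemma isSafe_empty (F : Finset (Finset α)) (E : Finset α) (p : ℕ) :
    IsSafe F E p (2 * #F) ∅ ∅ := by
  have hpotential : potential F p ∅ ∅ = #F := by simp [potential, weight]
  refine ⟨#F, by positivity, fun e _ => ?_, by rw [hpotential, two_mul]⟩
  exact hpotential ▸ danger_le_potential F p ∅ ∅ e

lemma IsSafe.exists_reply (h : IsSafe F E p C R B) (hp : 0 < p) (hME : M ⊆ E \ (R ∪ B))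
    (hM : #M ≤ p) :
    ∃ Y ⊆ E \ (R ∪ M ∪ B), #Y ≤ 1 ∧ ∀ B', B ⊆ B' → Y ⊆ B' → IsSafe F E p C (R ∪ M) B' := by
  obtain ⟨m, hm, hdanger, hC⟩ := h
  have hpotential : potential F p (R ∪ M) B ≤ C :=
    (potential_union_le hp hM hm fun e he => hdanger e (hME he)).trans hC
  have hfree {B'} (hB : B ⊆ B') : E \ (R ∪ M ∪ B') ⊆ E \ (R ∪ M ∪ B) :=
    sdiff_subset_sdiff subset_rfl (union_subset_union_right hB)
  obtain hfull | hne := (E \ (R ∪ M ∪ B)).eq_empty_or_nonempty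
  · refine ⟨∅, empty_subset _, by simp, fun B' hB _ => ⟨0, le_rfl, fun e he => ?_, ?_⟩⟩
    · exact absurd (hfull ▸ hfree hB he) (notMem_empty e)
    · rw [add_zero]
      exact (potential_anti_right F p _ hB).trans hpotential
  · obtain ⟨y, hy, hmax⟩ := exists_max_image _ (danger F p (R ∪ M) B) hne
    refine ⟨{y}, singleton_subset_iff.2 hy, by simp, fun B' hB hyB => ?_⟩
    refine ⟨danger F p (R ∪ M) B y, potential_nonneg _ _ _ _, fun e he => ?_, ?_⟩
    · exact (potential_anti_right _ p _ hB).trans (hmax e (hfree hB he))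
    · have hinsert : insert y B ⊆ B' := insert_subset (singleton_subset_iff.1 hyB) hB
      linarith [potential_anti_right F p (R ∪ M) hinsert,
        potential_insert_add_danger F p (R ∪ M) B y]

lemma IsSafe.not_subset (h : IsSafe F E p C R B) (hRB : Disjoint R B) (hA : A ∈ F)
    (hC : C < (2 : ℝ) ^ ((#A : ℝ) / p)) : ¬ A ⊆ R := by
  intro hAR
  obtain ⟨m, hm, -, hle⟩ := h
  have hweight : weight p R A ≤ potential F p R B :=
    single_le_sum (fun A _ => (weight_pos p R A).le) (mem_filter.2 ⟨hA, hRB.mono_left hAR⟩)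
  rw [weight, inter_eq_left.2 hAR] at hweight
  linarith

end Breaker

section Graph

variable {V : Type*}

lemma cliqueNum_lt_of_cliqueFree {G : SimpleGraph V} {L : ℕ} (h : G.CliqueFree L) :
    G.cliqueNum < L := by
  by_contra! hL
  obtain ⟨K, hK⟩ := G.exists_isNClique_cliqueNum
  exact h.mono hL K hK

lemma exists_mem_degree_mul_card_le [Fintype V] (G : SimpleGraph V) [DecidableRel G.Adj]
    [Fintype G.edgeSet] {N : Finset V} (hN : N.Nonempty) :
    ∃ w ∈ N, G.degree w * #N ≤ 2 * #G.edgeFinset := by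
  have hsum : ∑ v, G.degree v = 2 * #G.edgeFinset := by convert G.sum_degrees_eq_twice_card_edges
  refine exists_le_of_sum_le hN ?_
  rw [← sum_mul, sum_const, smul_eq_mul, mul_comm, ← hsum]
  gcongr
  exact subset_univ N

variable [DecidableEq V]

/-- The edges of the complete graph on `A`. -/
def cliqueEdges (A : Finset V) : Finset (Sym2 V) :=
  A.offDiag.image Sym2.mk.uncurry

lemma card_cliqueEdges (A : Finset V) : #(cliqueEdges A) = (#A).choose 2 :=
  Sym2.card_image_offDiag A

lemma isClique_fromEdgeSet_iff {R : Finset (Sym2 V)} {A : Finset V} :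
    (SimpleGraph.fromEdgeSet (R : Set (Sym2 V))).IsClique A ↔ cliqueEdges A ⊆ R := by
  simp only [SimpleGraph.isClique_iff, Set.Pairwise, SimpleGraph.fromEdgeSet_adj, mem_coe,
    cliqueEdges, image_subset_iff, Prod.forall, mem_offDiag, Function.uncurry_apply_pair]
  exact ⟨fun h x y hxy => (h hxy.1 hxy.2.1 hxy.2.2).1,
    fun h x hx y hy hxy => ⟨h x y ⟨hx, hy, hxy⟩, hxy⟩⟩

lemma card_le_card_filter_mk_notMem_add (M : Finset (Sym2 V)) (U : Finset V) (v : V) :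
    #U ≤ #{u ∈ U | s(v, u) ∉ M} + #M := by
  have hmem : #{u ∈ U | s(v, u) ∈ M} ≤ #M :=
    card_le_card_of_injOn (s(v, ·)) (fun _ hu => (mem_filter.1 hu).2)
      fun _ _ _ _ huu' => Sym2.congr_right.1 huu'
  linarith [card_filter_add_card_filter_not (s := U) (fun u => s(v, u) ∈ M)]

end Graph

section Strategy

variable {V : Type*} [Fintype V] [DecidableEq V] {G : SimpleGraph V} [DecidableRel G.Adj]
  {p q : ℕ} {P : Position V} {M B X : Finset (Sym2 V)}

lemma exists_isMove_superset (hX : X ⊆ uncoloured G P) (hq : #X ≤ q) :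
    ∃ B, X ⊆ B ∧ IsMove G q P B := by
  obtain ⟨B, hXB, hB, hcard⟩ := exists_subsuperset_card_eq hX
    (le_min hq (card_le_card hX)) (min_le_right q _)
  exact ⟨B, hXB, hB, hcard⟩

lemma disjoint_addRed (h : Disjoint P.red P.blue) (hM : M ⊆ uncoloured G P) :
    Disjoint (P.addRed M).red (P.addRed M).blue :=
  disjoint_union_left.2 ⟨h, (disjoint_union_right.1 (disjoint_sdiff.symm.mono_left hM)).2⟩

lemma disjoint_addBlue (h : Disjoint P.red P.blue) (hB : B ⊆ uncoloured G P) :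
    Disjoint (P.addBlue B).red (P.addBlue B).blue :=
  disjoint_union_right.2 ⟨h, (disjoint_union_right.1 (disjoint_sdiff.symm.mono_left hB)).1.symm⟩

lemma secondPlayerWins_of_invariant (I : Position V → Prop) (hstart : I ⟨∅, ∅⟩)
    (hround : ∀ P M, I P → IsMove G p P M →
      ∃ B, IsMove G q (P.addRed M) B ∧ I ((P.addRed M).addBlue B))
    (hend : ∀ P, I P → uncoloured G P = ∅ →
      (SimpleGraph.fromEdgeSet (P.red : Set (Sym2 V))).cliqueNum <
        (SimpleGraph.fromEdgeSet (P.blue : Set (Sym2 V))).cliqueNum) :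
    SecondPlayerWins G p q := by
  have hmove (Q : Position V) : ∃ B, IsMove G q Q B ∧
      ((∃ B', IsMove G q Q B' ∧ I (Q.addBlue B')) → I (Q.addBlue B)) := by
    by_cases hgood : ∃ B', IsMove G q Q B' ∧ I (Q.addBlue B')
    · obtain ⟨B', hB', hI⟩ := hgood
      exact ⟨B', hB', fun _ => hI⟩
    · obtain ⟨B, -, hB⟩ := exists_isMove_superset (q := q) (empty_subset (uncoloured G Q)) (by simp)
      exact ⟨B, hB, fun h => absurd h hgood⟩
  choose σ hσ hI using hmove
  refine ⟨σ, hσ, fun P hP => hend P ?_⟩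
  induction hP with
  | start => exact hstart
  | round P M _ hM ih => exact hI _ (hround P M ih hM)

end Strategy

section Stage

variable {V : Type*} {P : Position V} {S N U W : Finset V} {v w : V}

/-- The graph formed by the red edges of a position. -/
abbrev Position.redGraph (P : Position V) : SimpleGraph V :=
  SimpleGraph.fromEdgeSet (P.red : Set (Sym2 V))

/-- The graph formed by the blue edges of a position. -/
abbrev Position.blueGraph (P : Position V) : SimpleGraph V :=
  SimpleGraph.fromEdgeSet (P.blue : Set (Sym2 V))

lemma card_edgeFinset_redGraph_le (P : Position V) [Fintype P.redGraph.edgeSet] :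
    #P.redGraph.edgeFinset ≤ #P.red := by
  refine card_le_card fun e he => ?_
  rw [SimpleGraph.mem_edgeFinset, SimpleGraph.edgeSet_fromEdgeSet] at he
  exact mem_coe.1 he.1

/-- A stage of Bob's construction of a blue clique: `S` is the clique built so far and `v` its
latest vertex. The candidates for the next vertex are those in `N`, already joined in blue to all
of `S`, and those in `U`, which are joined to all of `S` but `v` and can still be joined to `v`. -/
structure IsStage (P : Position V) (S N U : Finset V) (v : V) : Prop where
  mem : v ∈ S
  isClique : P.blueGraph.IsClique S
  adj_joined : ∀ x ∈ S, ∀ u ∈ N, P.blueGraph.Adj x u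
  adj_pending : ∀ x ∈ S, x ≠ v → ∀ u ∈ U, P.blueGraph.Adj x u
  notMem_pending : v ∉ U
  notMem_red : ∀ u ∈ U, s(v, u) ∉ P.red
  disjoint : Disjoint N U

lemma IsStage.notMem_of_mem_joined (h : IsStage P S N U v) (hw : w ∈ N) : w ∉ S :=
  fun hwS => (h.adj_joined w hwS w hw).ne rfl

lemma IsStage.card_joined_lt [Fintype V] (h : IsStage P S N U v) : #N < Fintype.card V :=
  card_lt_univ_of_notMem fun hv => h.notMem_of_mem_joined hv h.mem

variable [DecidableEq V]

lemma blueGraph_le_addBlue {B : Finset (Sym2 V)} : P.blueGraph ≤ (P.addBlue B).blueGraph :=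
  SimpleGraph.fromEdgeSet_mono (coe_subset.2 subset_union_left)

lemma IsStage.addRed (h : IsStage P S N U v) (M : Finset (Sym2 V)) :
    IsStage (P.addRed M) S N {u ∈ U | s(v, u) ∉ M} v where
  mem := h.mem
  isClique := h.isClique
  adj_joined := h.adj_joined
  adj_pending x hx hxv u hu := h.adj_pending x hx hxv u (mem_filter.1 hu).1
  notMem_pending hv := h.notMem_pending (mem_filter.1 hv).1
  notMem_red u hu := by
    rw [mem_filter] at hu
    exact notMem_union.2 ⟨h.notMem_red u hu.1, hu.2⟩
  disjoint := h.disjoint.mono_right (filter_subset _ _)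

lemma IsStage.addBlue (h : IsStage P S N U v) (B : Finset (Sym2 V)) :
    IsStage (P.addBlue B) S N U v where
  mem := h.mem
  isClique := h.isClique.mono blueGraph_le_addBlue
  adj_joined x hx u hu := blueGraph_le_addBlue (h.adj_joined x hx u hu)
  adj_pending x hx hxv u hu := blueGraph_le_addBlue (h.adj_pending x hx hxv u hu)
  notMem_pending := h.notMem_pending
  notMem_red := h.notMem_red
  disjoint := h.disjoint

lemma IsStage.union_sdiff (h : IsStage P S N U v) (hW : W ⊆ U)
    (hadj : ∀ u ∈ W, P.blueGraph.Adj v u) : IsStage P S (N ∪ W) (U \ W) v where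
  mem := h.mem
  isClique := h.isClique
  adj_joined x hx u hu := by
    obtain hu | hu := mem_union.1 hu
    · exact h.adj_joined x hx u hu
    · obtain rfl | hxv := eq_or_ne x v
      · exact hadj u hu
      · exact h.adj_pending x hx hxv u (hW hu)
  adj_pending x hx hxv u hu := h.adj_pending x hx hxv u (sdiff_subset hu)
  notMem_pending hv := h.notMem_pending (sdiff_subset hv)
  notMem_red u hu := h.notMem_red u (sdiff_subset hu)
  disjoint := disjoint_union_left.2 ⟨h.disjoint.mono_right sdiff_subset, disjoint_sdiff⟩

lemma IsStage.exists_join [Fintype V] (h : IsStage P S N U v) (hW : W ⊆ U) :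
    ∃ X ⊆ uncoloured ⊤ P, #X ≤ #W ∧
      ∀ B, X ⊆ B → IsStage (P.addBlue B) S (N ∪ W) (U \ W) v := by
  have hne {u : V} (hu : u ∈ W) : v ≠ u := fun hvu => h.notMem_pending (hvu ▸ hW hu)
  refine ⟨W.image (s(v, ·)) \ P.blue, fun e he => ?_,
    (card_le_card sdiff_subset).trans card_image_le, fun B hB => ?_⟩
  · obtain ⟨heW, he⟩ := mem_sdiff.1 he
    obtain ⟨u, hu, rfl⟩ := mem_image.1 heW
    exact mem_sdiff.2 ⟨SimpleGraph.mem_edgeFinset.2 (hne hu),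
      notMem_union.2 ⟨h.notMem_red u (hW hu), he⟩⟩
  · refine (h.addBlue B).union_sdiff hW fun u hu => ?_
    have hblue : s(v, u) ∈ P.blue ∪ B := by
      by_cases hvu : s(v, u) ∈ P.blue
      · exact mem_union_left _ hvu
      · exact mem_union_right _ (hB (mem_sdiff.2 ⟨mem_image_of_mem _ hu, hvu⟩))
    exact (SimpleGraph.fromEdgeSet_adj _).2 ⟨hblue, hne hu⟩

lemma IsStage.restart (h : IsStage P S N U v) (hw : w ∈ N) :
    IsStage P (insert w S) ∅ {u ∈ N.erase w | s(w, u) ∉ P.red} w where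
  mem := mem_insert_self w S
  isClique := by
    rw [coe_insert]
    exact h.isClique.insert fun x hx _ => (h.adj_joined x hx w hw).symm
  adj_joined := by simp
  adj_pending x hx hxw u hu := h.adj_joined x (mem_of_mem_insert_of_ne hx hxw) u
    (mem_of_mem_erase (mem_filter.1 hu).1)
  notMem_pending := by simp
  notMem_red u hu := (mem_filter.1 hu).2
  disjoint := disjoint_empty_left _

lemma card_le_card_erase_filter_add_degree [Fintype V] (P : Position V) (N : Finset V) (w : V) :
    #N ≤ #{u ∈ N.erase w | s(w, u) ∉ P.red} + 1 + P.redGraph.degree w := by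
  have hred : #{u ∈ N.erase w | s(w, u) ∈ P.red} ≤ P.redGraph.degree w := by
    refine card_le_card fun u hu => ?_
    obtain ⟨hu, hwu⟩ := mem_filter.1 hu
    rw [SimpleGraph.mem_neighborFinset, SimpleGraph.fromEdgeSet_adj]
    exact ⟨hwu, (ne_of_mem_erase hu).symm⟩
  have hsplit := card_filter_add_card_filter_not (s := N.erase w) (fun u => s(w, u) ∈ P.red)
  have herase := pred_card_le_card_erase (s := N) (a := w)
  omega

end Stage

section Schedule

variable {V : Type*}

/-- Bounds on the numbers of candidates that Bob can guarantee at the various stages of his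
construction: `a k` candidates when his clique has just got its `k`-th vertex. While he joins that
vertex to the candidates, `r` per turn, Alice spoils at most `p` per turn, so that `a k` candidates
become at least `ν`, where `r * a k ≤ r * (r + p) + (r + p) * ν`. Among these he picks a vertex `w`
of red degree `d`, where `d * ν` is at most twice the number of red edges; then `w` itself and
its red neighbours are no candidates any more. -/
structure IsSchedule (p r n L : ℕ) (a : ℕ → ℝ) : Prop where
  one_le : a 1 ≤ n - 1
  pos : ∀ k < L, ∀ ν : ℕ, r * a k ≤ r * (r + p) + (r + p) * ν → 0 < ν
  succ_le : ∀ k < L, ∀ ν d : ℕ, r * a k ≤ r * (r + p) + (r + p) * ν → d * ν ≤ 2 * (p * (n * L)) →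
    a (k + 1) + 1 + d ≤ ν

variable [Fintype V]

/-- After `τ` rounds the stage with clique `S` and candidates `N` and `U` is on pace for the
schedule `a`. Joining `r` candidates costs Bob `r + p` of them in `U`, hence the weights in
`size_le`. -/
structure IsOnPace (p r : ℕ) (a : ℕ → ℝ) (P : Position V) (τ : ℕ) (S N U : Finset V) : Prop where
  card_red_le : #P.red ≤ p * τ
  time_le : τ ≤ Fintype.card V * #S + #N
  size_le : r * a #S ≤ r * #U + (r + p) * #N

/-- After `τ` rounds Bob has a blue clique with `L` vertices, or is on his way to it. -/
def IsBuilding (p r L : ℕ) (a : ℕ → ℝ) (P : Position V) (τ : ℕ) : Prop :=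
  (∃ S, P.blueGraph.IsNClique L S) ∨
    ∃ S N U v, #S < L ∧ IsStage P S N U v ∧ IsOnPace p r a P τ S N U

lemma IsBuilding.start [Nonempty V] {p r L : ℕ} {a : ℕ → ℝ} (hL : 1 < L)
    (ha : IsSchedule p r (Fintype.card V) L a) : IsBuilding (V := V) p r L a ⟨∅, ∅⟩ 0 := by
  classical
  obtain ⟨v⟩ := ‹Nonempty V›
  have hstage : IsStage ⟨∅, ∅⟩ {v} ∅ (univ.erase v) v :=
    { mem := mem_singleton_self v
      isClique := by simp
      adj_joined := by simp
      adj_pending := fun x hx hxv => absurd (mem_singleton.1 hx) hxv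
      notMem_pending := by simp
      notMem_red := by simp
      disjoint := disjoint_empty_left _ }
  have hcard : (#(univ.erase v) : ℝ) = Fintype.card V - 1 := by
    rw [card_erase_of_mem (mem_univ v), card_univ, Nat.cast_pred Fintype.card_pos]
  refine Or.inr ⟨{v}, ∅, univ.erase v, v, by simpa, hstage, by simp, by simp, ?_⟩
  rw [card_singleton, hcard, card_empty, Nat.cast_zero, mul_zero, add_zero]
  gcongr
  exact ha.one_le

variable [DecidableEq V] {p r L τ : ℕ} {a : ℕ → ℝ} {P : Position V} {S N U N' U' W : Finset V}
  {v w : V} {M : Finset (Sym2 V)}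

lemma IsOnPace.card_addRed_le (h : IsOnPace p r a P τ S N U) (hM : #M ≤ p) :
    #(P.addRed M).red ≤ p * (τ + 1) :=
  (card_union_le P.red M).trans (add_le_add h.card_red_le hM)

lemma IsOnPace.join (h : IsOnPace p r a P τ S N U) (hr : 1 ≤ r) (hM : #M ≤ p)
    (hN : #N' = #N + r) (hU : #U ≤ #U' + (r + p)) (B : Finset (Sym2 V)) :
    IsOnPace p r a ((P.addRed M).addBlue B) (τ + 1) S N' U' where
  card_red_le := h.card_addRed_le hM
  time_le := by linarith [h.time_le]
  size_le := by
    have hU' : (#U : ℝ) ≤ #U' + (r + p) := by exact_mod_cast hU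
    calc (r * a #S : ℝ) ≤ r * #U + (r + p) * #N := h.size_le
      _ ≤ r * (#U' + (r + p)) + (r + p) * #N := by gcongr
      _ = r * #U' + (r + p) * #N' := by
        rw [hN]
        push_cast
        ring

lemma IsOnPace.restart (h : IsOnPace p r a P τ S N U) (ha : IsSchedule p r (Fintype.card V) L a)
    (hM : #M ≤ p) (hS : #S < L) (hN : #N < Fintype.card V) (hU : #U ≤ r + p) (hw : w ∉ S) {d : ℕ}
    (hd : d * #N ≤ 2 * #(P.addRed M).red) (hU' : #N ≤ #U' + 1 + d) (B : Finset (Sym2 V)) :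
    IsOnPace p r a ((P.addRed M).addBlue B) (τ + 1) (insert w S) ∅ U' := by
  have htime : τ + 1 ≤ Fintype.card V * (#S + 1) := by linarith [h.time_le]
  have hred : #(P.addRed M).red ≤ p * (Fintype.card V * L) :=
    (h.card_addRed_le hM).trans (by gcongr; exact htime.trans (by gcongr; exact hS))
  have hsize : (r * a #S : ℝ) ≤ r * (r + p) + (r + p) * #N :=
    h.size_le.trans (by gcongr; exact_mod_cast hU)
  have hnext := ha.succ_le #S hS #N d hsize (hd.trans (by gcongr))
  have hU'' : (#N : ℝ) ≤ #U' + 1 + d := by exact_mod_cast hU'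
  refine ⟨h.card_addRed_le hM, ?_, ?_⟩ <;> rw [card_insert_of_notMem hw, card_empty]
  · exact htime
  · rw [Nat.cast_zero, mul_zero, add_zero]
    gcongr
    linarith

lemma IsStage.exists_reply_join (h : IsStage P S N U v) (hpace : IsOnPace p r a P τ S N U)
    (hr : 1 ≤ r) (hM : #M ≤ p) (hS : #S < L) (hmany : r ≤ #{u ∈ U | s(v, u) ∉ M}) :
    ∃ X ⊆ uncoloured ⊤ (P.addRed M), #X ≤ r ∧
      ∀ B, X ⊆ B → IsBuilding p r L a ((P.addRed M).addBlue B) (τ + 1) := by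
  obtain ⟨W, hW, hWr⟩ := exists_subset_card_eq hmany
  obtain ⟨X, hX, hXW, hjoin⟩ := (h.addRed M).exists_join hW
  have hN : #(N ∪ W) = #N + r := by
    rw [card_union_of_disjoint ((h.addRed M).disjoint.mono_right hW), hWr]
  have hU : #U ≤ #({u ∈ U | s(v, u) ∉ M} \ W) + (r + p) := by
    linarith [card_sdiff_add_card_eq_card hW, card_le_card_filter_mk_notMem_add M U v]
  exact ⟨X, hX, hXW.trans hWr.le, fun B hB =>
    Or.inr ⟨S, _, _, v, hS, hjoin B hB, hpace.join hr hM hN hU B⟩⟩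

lemma IsStage.isBuilding_restart (h : IsStage P S N U v) (hpace : IsOnPace p r a P τ S N U)
    (ha : IsSchedule p r (Fintype.card V) L a) (hM : #M ≤ p) (hS : #S < L)
    (hfew : #{u ∈ U | s(v, u) ∉ M} ≤ r) (B : Finset (Sym2 V)) :
    IsBuilding p r L a ((P.addRed M).addBlue B) (τ + 1) := by
  have hU : #U ≤ r + p := by linarith [card_le_card_filter_mk_notMem_add M U v]
  have hN : 0 < #N :=
    ha.pos #S hS #N (hpace.size_le.trans (by gcongr; exact_mod_cast hU))
  obtain ⟨w, hw, hdegree⟩ := exists_mem_degree_mul_card_le (P.addRed M).redGraph (card_pos.1 hN)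
  have hwS : w ∉ S := h.notMem_of_mem_joined hw
  have hstage := ((h.addRed M).restart hw).addBlue B
  have hpace' := hpace.restart ha hM hS h.card_joined_lt hU hwS
    (hdegree.trans (Nat.mul_le_mul_left 2 (card_edgeFinset_redGraph_le (P.addRed M))))
    (card_le_card_erase_filter_add_degree (P.addRed M) N w) B
  have hcard : #(insert w S) = #S + 1 := card_insert_of_notMem hwS
  obtain hL | hL := (Nat.succ_le_of_lt hS).eq_or_lt
  · exact Or.inl ⟨insert w S, hstage.isClique, hcard.trans hL⟩
  · exact Or.inr ⟨insert w S, ∅, _, w, hcard.trans_lt hL, hstage, hpace'⟩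

lemma IsBuilding.exists_reply (h : IsBuilding p r L a P τ) (hr : 1 ≤ r)
    (ha : IsSchedule p r (Fintype.card V) L a) (hM : #M ≤ p) :
    ∃ X ⊆ uncoloured ⊤ (P.addRed M), #X ≤ r ∧
      ∀ B, X ⊆ B → IsBuilding p r L a ((P.addRed M).addBlue B) (τ + 1) := by
  obtain ⟨S, hS⟩ | ⟨S, N, U, v, hS, hstage, hpace⟩ := h
  · exact ⟨∅, empty_subset _, by simp, fun B _ => Or.inl ⟨S, hS.mono blueGraph_le_addBlue⟩⟩
  obtain hmany | hfew := le_total r #{u ∈ U | s(v, u) ∉ M}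
  · exact hstage.exists_reply_join hpace hr hM hS hmany
  · exact ⟨∅, empty_subset _, by simp, fun B _ => hstage.isBuilding_restart hpace ha hM hS hfew B⟩

lemma IsBuilding.exists_isNClique (h : IsBuilding p r L a P τ) (hr : 1 ≤ r)
    (ha : IsSchedule p r (Fintype.card V) L a) (hP : uncoloured ⊤ P = ∅) :
    ∃ S, P.blueGraph.IsNClique L S := by
  -- When no edge is left, empty turns can be added without end, but building takes bounded time.
  have hforever (t : ℕ) : IsBuilding p r L a P (τ + t) := by
    induction t with
    | zero => exact h
    | succ t ih =>
      obtain ⟨X, hX, -, hB⟩ := ih.exists_reply hr ha (M := ∅) (by simp)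
      have hred : P.addRed ∅ = P := by simp [Position.addRed]
      have hblue : P.addBlue ∅ = P := by simp [Position.addBlue]
      rw [hred] at hX hB
      simpa only [hblue, add_assoc] using hB ∅ (hP ▸ hX)
  obtain hclique | ⟨S, N, U, v, hS, -, hpace⟩ :=
    hforever (Fintype.card V * L + Fintype.card V + 1)
  · exact hclique
  · have hSL : Fintype.card V * #S ≤ Fintype.card V * L := by gcongr
    linarith [hpace.time_le, card_le_univ N]

end Schedule

section Numerics

open Filter Asymptotics

variable {p r n L : ℕ}

/-- The proportion of his candidates that Bob can count on keeping with every new vertex of his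
clique. Joining the vertex costs him the proportion `p / r`, and the losses of lower order are
charged to another `p / r`. -/
noncomputable def retention (p r : ℕ) : ℝ :=
  1 - 2 * (p / r)

lemma div_mul_le_of_sq_le (hp : 0 < p) (hr : 16 * p ^ 2 ≤ r) : (p / r : ℝ) * p ≤ 1 / 16 := by
  have hr' : (16 : ℝ) * p ^ 2 ≤ r := by exact_mod_cast hr
  have hr0 : (0 : ℝ) < r := lt_of_lt_of_le (by positivity) hr'
  rw [div_mul_eq_mul_div, div_le_div_iff₀ hr0 (by norm_num)]
  linarith

lemma div_le_of_sq_le (hp : 0 < p) (hr : 16 * p ^ 2 ≤ r) : (p / r : ℝ) ≤ 1 / 16 :=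
  (le_mul_of_one_le_right (by positivity) (by exact_mod_cast hp)).trans (div_mul_le_of_sq_le hp hr)

lemma retention_pos (hp : 0 < p) (hr : 16 * p ^ 2 ≤ r) : 0 < retention p r := by
  unfold retention
  linarith [div_le_of_sq_le hp hr]

lemma retention_le_one (p r : ℕ) : retention p r ≤ 1 :=
  sub_le_self 1 (by positivity)

lemma mul_one_sub_sub_le_of_size_le (hr : 0 < r) {b ν : ℝ} (hb : 0 ≤ b)
    (h : r * b ≤ r * (r + p) + (r + p) * ν) : b * (1 - p / r) - r ≤ ν := by
  refine le_of_mul_le_mul_left ?_ (by positivity : (0 : ℝ) < r + p)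
  calc (r + p) * (b * (1 - p / r) - r) = r * b - b * (p ^ 2 / r) - r * (r + p) := by
        field_simp
        ring
    _ ≤ r * b - r * (r + p) := by linarith [show 0 ≤ b * (p ^ 2 / r) by positivity]
    _ ≤ (r + p) * ν := by linarith

lemma half_le_of_size_le (hp : 0 < p) (hr : 16 * p ^ 2 ≤ r) {b ν : ℝ} (hb : r ≤ b * (p / r))
    (h : r * b ≤ r * (r + p) + (r + p) * ν) : b / 2 ≤ ν := by
  have hr0 : 0 < r := lt_of_lt_of_le (by positivity) hr
  have hb0 : 0 < b := pos_of_mul_pos_left (lt_of_lt_of_le (by positivity) hb) (by positivity)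
  have hsmall := mul_le_mul_of_nonneg_left (div_le_of_sq_le hp hr) hb0.le
  linarith [mul_one_sub_sub_le_of_size_le hr0 hb0.le h]

lemma degree_le_div {s : ℝ} {ν d : ℕ} (hn : 0 < n) (hs : 0 < s) (hν : n * s / 2 ≤ ν)
    (hd : d * ν ≤ 2 * (p * (n * L))) : d ≤ 4 * p * L / s := by
  have hn' : (0 : ℝ) < n := by exact_mod_cast hn
  have hd' : (d : ℝ) * ν ≤ 2 * (p * (n * L)) := by exact_mod_cast hd
  rw [le_div_iff₀ hs]
  refine le_of_mul_le_mul_left ?_ hn'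
  linarith [mul_le_mul_of_nonneg_left hν d.cast_nonneg]

lemma isSchedule_retention (hp : 0 < p) (hr : 16 * p ^ 2 ≤ r)
    (hL : r + 1 + 4 * p * L / retention p r ^ L ≤ n * retention p r ^ L * (p / r)) :
    IsSchedule p r n L (fun k => n * retention p r ^ k) := by
  have hr0 : 0 < r := lt_of_lt_of_le (by positivity) hr
  have hρ0 : 0 < retention p r := retention_pos hp hr
  have hpow {k : ℕ} (hk : k ≤ L) : retention p r ^ L ≤ retention p r ^ k :=
    pow_le_pow_of_le_one hρ0.le (retention_le_one p r) hk
  have hloss : 0 ≤ 4 * p * L / retention p r ^ L := by positivity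
  have hmargin {k : ℕ} (hk : k ≤ L) :
      r + 1 + 4 * p * L / retention p r ^ L ≤ n * retention p r ^ k * (p / r) :=
    hL.trans (mul_le_mul_of_nonneg_right (mul_le_mul_of_nonneg_left (hpow hk) n.cast_nonneg)
      (by positivity))
  have hpos {k : ℕ} (hk : k ≤ L) : 0 < n * retention p r ^ k :=
    pos_of_mul_pos_left (lt_of_lt_of_le (by positivity) (hmargin hk)) (by positivity)
  have hhalf {k ν : ℕ} (hk : k < L)
      (h : r * (n * retention p r ^ k) ≤ r * (r + p) + (r + p) * ν) :
      n * retention p r ^ k / 2 ≤ ν :=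
    half_le_of_size_le hp hr (by linarith [hmargin hk.le]) h
  refine ⟨?_, fun k hk ν h => ?_, fun k hk ν d h hd => ?_⟩
  · have hmargin0 := hmargin L.zero_le
    rw [pow_zero, mul_one] at hmargin0
    rw [pow_one, retention]
    linarith [show (0 : ℝ) ≤ r by positivity]
  · exact_mod_cast (half_pos (hpos hk.le)).trans_le (hhalf hk h)
  · have hn : (0 : ℝ) < n := pos_of_mul_pos_left (hpos hk.le) (by positivity)
    have hdegree : (d : ℝ) ≤ 4 * p * L / retention p r ^ L :=
      (degree_le_div (mod_cast hn) (by positivity) (hhalf hk h) hd).trans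
        (by gcongr 4 * p * L / ?_; exact hpow hk.le)
    have hkeep : n * retention p r ^ (k + 1) =
        n * retention p r ^ k * (1 - p / r) - n * retention p r ^ k * (p / r) := by
      rw [pow_succ, retention]
      ring
    linarith [mul_one_sub_sub_le_of_size_le hr0 (hpos hk.le).le h, hmargin hk.le]

/-- The number of vertices of the cliques that Bob keeps Alice from building. -/
def cliqueBound (p n : ℕ) : ℕ :=
  2 * p * (Nat.log 2 n + 1) + 1

lemma one_lt_cliqueBound (hp : 0 < p) (n : ℕ) : 1 < cliqueBound p n :=
  Nat.lt_add_of_pos_left (by positivity)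

lemma two_mul_choose_cliqueBound_lt (hp : 0 < p) (n : ℕ) :
    (2 : ℝ) * n.choose (cliqueBound p n) < 2 ^ (((cliqueBound p n).choose 2 : ℝ) / p) := by
  have hexponent : ((cliqueBound p n).choose 2 : ℝ) / p =
      ((Nat.log 2 n + 1) * cliqueBound p n : ℕ) := by
    rw [Nat.cast_choose_two, cliqueBound]
    push_cast
    field_simp
    ring
  rw [hexponent, Real.rpow_natCast]
  have hL : 1 < cliqueBound p n := one_lt_cliqueBound hp n
  have hlt : 2 * n.choose (cliqueBound p n) < 2 ^ ((Nat.log 2 n + 1) * cliqueBound p n) :=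
    calc 2 * n.choose (cliqueBound p n)
        ≤ (cliqueBound p n).factorial * n.choose (cliqueBound p n) := by
          gcongr
          exact hL.trans_le (Nat.self_le_factorial _)
      _ = n.descFactorial (cliqueBound p n) := (Nat.descFactorial_eq_factorial_mul_choose _ _).symm
      _ ≤ n ^ cliqueBound p n := Nat.descFactorial_le_pow _ _
      _ < (2 ^ (Nat.log 2 n + 1)) ^ cliqueBound p n :=
          Nat.pow_lt_pow_left (Nat.lt_pow_succ_log_self one_lt_two n) (by lia)
      _ = 2 ^ ((Nat.log 2 n + 1) * cliqueBound p n) := (pow_mul _ _ _).symm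
  exact_mod_cast hlt

lemma three_fourths_pow_le_retention_pow (hp : 0 < p) (hr : 16 * p ^ 2 ≤ r) (n : ℕ) :
    (3 / 4 : ℝ) ^ (Nat.log 2 n + 2) ≤ retention p r ^ cliqueBound p n := by
  have hρ0 : 0 < retention p r := retention_pos hp hr
  have hbernoulli : 3 / 4 ≤ retention p r ^ (2 * p) := by
    have h := one_add_mul_sub_le_pow (a := retention p r) (by linarith) (2 * p)
    rw [retention] at h ⊢
    push_cast at h
    linarith [div_mul_le_of_sq_le hp hr]
  have hle : cliqueBound p n ≤ 2 * p * (Nat.log 2 n + 2) := by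
    rw [cliqueBound]
    linarith
  calc (3 / 4 : ℝ) ^ (Nat.log 2 n + 2) ≤ (retention p r ^ (2 * p)) ^ (Nat.log 2 n + 2) := by gcongr
    _ = retention p r ^ (2 * p * (Nat.log 2 n + 2)) := (pow_mul _ _ _).symm
    _ ≤ retention p r ^ cliqueBound p n :=
        pow_le_pow_of_le_one hρ0.le (retention_le_one p r) hle

lemma eventually_add_mul_le_mul_pow {c θ : ℝ} (a b : ℝ) (hc : 0 < c) (hθ : 1 < θ) :
    ∀ᶠ ℓ : ℕ in atTop, a + b * ℓ ≤ c * θ ^ ℓ := by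
  have hconst : (fun _ : ℕ => a) =o[atTop] (fun ℓ : ℕ => θ ^ ℓ) := by
    simpa using (isLittleO_pow_const_const_pow_of_one_lt (R := ℝ) 0 hθ).const_mul_left a
  have hlinear : (fun ℓ : ℕ => b * (ℓ : ℝ)) =o[atTop] (fun ℓ : ℕ => θ ^ ℓ) :=
    (isLittleO_coe_const_pow_of_one_lt hθ).const_mul_left b
  filter_upwards [(hconst.add hlinear).def hc] with ℓ hℓ
  rw [Real.norm_of_nonneg (by positivity : 0 ≤ θ ^ ℓ)] at hℓ
  exact (le_abs_self _).trans hℓ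

lemma tendsto_natLog_atTop {b : ℕ} (hb : 1 < b) : Tendsto (Nat.log b) atTop atTop :=
  tendsto_atTop.2 fun k => (eventually_ge_atTop (b ^ k)).mono fun _ hn => Nat.le_log_of_pow_le hb hn

lemma eventually_isSchedule_retention (hp : 0 < p) (hr : 16 * p ^ 2 ≤ r) :
    ∀ᶠ n : ℕ in atTop, IsSchedule p r n (cliqueBound p n) (fun k => n * retention p r ^ k) := by
  have hr0 : (0 : ℝ) < r := by exact_mod_cast lt_of_lt_of_le (by positivity) hr
  have hlog := (tendsto_natLog_atTop one_lt_two).eventually <|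
    eventually_add_mul_le_mul_pow (r + 1 + 4 * p * (2 * p + 1)) (4 * p * (2 * p))
      (show (0 : ℝ) < 81 / 256 * (p / r) by positivity) (show (1 : ℝ) < 9 / 8 by norm_num)
  filter_upwards [hlog, eventually_ne_atTop 0] with n hℓ hn
  refine isSchedule_retention hp hr ?_
  have hρ := three_fourths_pow_le_retention_pow hp hr n
  have hn2 : (2 : ℝ) ^ Nat.log 2 n ≤ n := by exact_mod_cast Nat.pow_log_le_self 2 hn
  have hL : (cliqueBound p n : ℝ) = 2 * p * Nat.log 2 n + (2 * p + 1) := by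
    rw [cliqueBound]
    push_cast
    ring
  set s : ℝ := (3 / 4) ^ (Nat.log 2 n + 2) with hs
  have hs0 : 0 < s := by positivity
  have hs1 : s ≤ 1 := pow_le_one₀ (by norm_num) (by norm_num)
  calc r + 1 + 4 * p * cliqueBound p n / retention p r ^ cliqueBound p n
      ≤ (r + 1) / s + 4 * p * cliqueBound p n / s := by
        gcongr
        exact le_div_self (by positivity) hs0 hs1
    _ = (r + 1 + 4 * p * (2 * p + 1) + 4 * p * (2 * p) * Nat.log 2 n) / s := by
        rw [hL]
        ring
    _ ≤ 81 / 256 * (p / r) * (9 / 8) ^ Nat.log 2 n / s := by gcongr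
    _ = 2 ^ Nat.log 2 n * s * (p / r) := by
        rw [div_eq_iff hs0.ne', hs, show (9 / 8 : ℝ) = 2 * (3 / 4) * (3 / 4) by norm_num, mul_pow,
          mul_pow]
        ring
    _ ≤ n * retention p r ^ cliqueBound p n * (p / r) := by gcongr

end Numerics

section Win

variable {V : Type*} [Fintype V] [DecidableEq V] {p r L : ℕ} {a : ℕ → ℝ} {P : Position V}
  {M : Finset (Sym2 V)}

/-- The winning sets of Alice's attempt to build a red clique with `L` vertices. -/
def cliqueFamily (V : Type*) [Fintype V] [DecidableEq V] (L : ℕ) : Finset (Finset (Sym2 V)) :=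
  (powersetCard L univ).image cliqueEdges

lemma card_cliqueFamily_le (V : Type*) [Fintype V] [DecidableEq V] (L : ℕ) :
    #(cliqueFamily V L) ≤ (Fintype.card V).choose L :=
  card_image_le.trans_eq (by rw [card_powersetCard, card_univ])

/-- What Bob maintains throughout the game: Alice is kept from a red clique with `L` vertices, and
he himself is on his way to a blue one. -/
structure IsOnTrack (p r L : ℕ) (a : ℕ → ℝ) (P : Position V) : Prop where
  disjoint : Disjoint P.red P.blue
  isSafe : IsSafe (cliqueFamily V L) (⊤ : SimpleGraph V).edgeFinset p (2 * #(cliqueFamily V L))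
    P.red P.blue
  isBuilding : ∃ τ, IsBuilding p r L a P τ

lemma IsOnTrack.exists_reply (h : IsOnTrack p r L a P) (hp : 0 < p) (hr : 1 ≤ r)
    (ha : IsSchedule p r (Fintype.card V) L a) (hM : IsMove ⊤ p P M) :
    ∃ B, IsMove ⊤ (r + 1) (P.addRed M) B ∧ IsOnTrack p r L a ((P.addRed M).addBlue B) := by
  obtain ⟨τ, hbuild⟩ := h.isBuilding
  have hMp : #M ≤ p := hM.2.trans_le (min_le_left _ _)
  obtain ⟨Y, hY, hY1, hsafe⟩ := h.isSafe.exists_reply hp hM.1 hMp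
  obtain ⟨X, hX, hXr, hbuild'⟩ := hbuild.exists_reply hr ha hMp
  obtain ⟨B, hXY, hB⟩ := exists_isMove_superset (union_subset hX hY)
    ((card_union_le X Y).trans (add_le_add hXr hY1))
  exact ⟨B, hB,
    { disjoint := disjoint_addBlue (disjoint_addRed h.disjoint hM.1) hB.1
      isSafe := hsafe _ subset_union_left ((union_subset_right hXY).trans subset_union_right)
      isBuilding := ⟨τ + 1, hbuild' B (union_subset_left hXY)⟩ }⟩

lemma IsOnTrack.cliqueFree_redGraph (h : IsOnTrack p r L a P)
    (hL : (2 : ℝ) * (Fintype.card V).choose L < 2 ^ ((L.choose 2 : ℝ) / p)) :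
    P.redGraph.CliqueFree L := by
  intro A hA
  have hmem : cliqueEdges A ∈ cliqueFamily V L :=
    mem_image_of_mem _ (mem_powersetCard.2 ⟨subset_univ A, hA.card_eq⟩)
  refine h.isSafe.not_subset h.disjoint hmem ?_ (isClique_fromEdgeSet_iff.1 hA.isClique)
  rw [card_cliqueEdges, hA.card_eq]
  refine lt_of_le_of_lt ?_ hL
  gcongr
  exact card_cliqueFamily_le V L

lemma secondPlayerWins_of_isSchedule [Nonempty V] (hp : 0 < p) (hr : 1 ≤ r) (hL : 1 < L)
    (hchoose : (2 : ℝ) * (Fintype.card V).choose L < 2 ^ ((L.choose 2 : ℝ) / p))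
    (ha : IsSchedule p r (Fintype.card V) L a) :
    SecondPlayerWins (⊤ : SimpleGraph V) p (r + 1) := by
  refine secondPlayerWins_of_invariant (IsOnTrack p r L a)
    ⟨disjoint_empty_left _, isSafe_empty _ _ p, 0, IsBuilding.start hL ha⟩
    (fun P M h hM => h.exists_reply hp hr ha hM) fun P h hP => ?_
  obtain ⟨τ, hbuild⟩ := h.isBuilding
  obtain ⟨S, hS⟩ := hbuild.exists_isNClique hr ha hP
  calc P.redGraph.cliqueNum < L := cliqueNum_lt_of_cliqueFree (h.cliqueFree_redGraph hchoose)
    _ = #S := hS.card_eq.symm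
    _ ≤ P.blueGraph.cliqueNum := hS.isClique.card_le_cliqueNum

end Win

end CliqueGame

theorem mainTheorem3 :
    ∃ c : ℝ, 0 < c ∧ ∀ p q : ℕ, 1 ≤ p → c * (p : ℝ) ^ 2 < (q : ℝ) →
      ∃ n₀ : ℕ, ∀ n : ℕ, n₀ ≤ n →
        CliqueGame.SecondPlayerWins (⊤ : SimpleGraph (Fin n)) p q := by
  refine ⟨16, by norm_num, fun p q hp hq => Filter.eventually_atTop.1 ?_⟩
  have hq' : 16 * p ^ 2 < q := by exact_mod_cast hq
  obtain ⟨r, rfl⟩ : ∃ r, q = r + 1 := Nat.exists_eq_succ_of_ne_zero (by lia)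
  have hr : 16 * p ^ 2 ≤ r := Nat.lt_succ_iff.1 hq'
  filter_upwards [CliqueGame.eventually_isSchedule_retention hp hr, Filter.eventually_ne_atTop 0]
    with n hschedule hn
  have : NeZero n := ⟨hn⟩
  exact CliqueGame.secondPlayerWins_of_isSchedule hp (by nlinarith)
    (CliqueGame.one_lt_cliqueBound hp n)
    (by simpa only [Fintype.card_fin] using CliqueGame.two_mul_choose_cliqueBound_lt hp n)
    (by simpa only [Fintype.card_fin] using hschedule)
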